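/- Let $W\ge 0$ be a random variable whose distribution is infinitely divisible, meaning that for every positive integer $n$ there are $n$ nonnegative independent identically distributed random variables $W_1,\dots,W_n$ (on some probability space) such that $W_1+\dots+W_n$ has the same distribution as $W$. Let $L(s)=\mathbb{E}\,e^{-sW}$, $s>0$, be its Laplace transform, and for every positive integer $m$ put $L_m(s)=L(ms)^{1/m}$, $s>0$. Then $L_m$ is the Laplace transform of a probability distribution on $[0,\infty)$ for every positive integer $m$. Moreover, the limit $$\lim_{m\to\infty}L_m(s)=D(s)$$ exists for every $s>0$, and $D$ is the Laplace transform of a degenerate distribution: there is $\sigma\ge 0$ such that $D(s)=e^{-\sigma s}$ for all $s>0$, which is the Laplace transform of the point mass at $\sigma$. Finally, $\mathbb{P}\{W<x\}>0$ for all $x>0$ if and only if $D(s)=1$ for all $s>0$. -/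

import Mathlib

open MeasureTheory ProbabilityTheory Filter Topology

noncomputable section

/-- The Laplace transform `s ↦ E exp (-s W)` of a real random variable `W`
on a probability space with measure `P`. -/
def laplaceTransform {Ω : Type*} [MeasurableSpace Ω] (W : Ω → ℝ) (P : Measure Ω) (s : ℝ) : ℝ :=
  ∫ ω, Real.exp (-s * W ω) ∂P

/-- `f` is, on `s > 0`, the Laplace transform of a probability distribution `ν`
concentrated on the nonnegative half-line. -/
def IsLaplaceTransform (f : ℝ → ℝ) : Prop :=
  ∃ ν : Measure ℝ, IsProbabilityMeasure ν ∧ (∀ᵐ x ∂ν, 0 ≤ x) ∧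
    ∀ s : ℝ, 0 < s → f s = laplaceTransform id ν s

/-- Infinite divisibility within nonnegative random variables: for every positive integer `n`
there are (on some probability space) `n` nonnegative i.i.d. random variables whose sum has the
distribution of `W`. -/
def IsNonnegInfinitelyDivisible {Ω : Type*} [MeasurableSpace Ω] (W : Ω → ℝ) (P : Measure Ω) :
    Prop :=
  ∀ n : ℕ, 0 < n →
    ∃ (Ω' : Type) (_ : MeasurableSpace Ω') (Q : Measure Ω') (Y : Fin n → Ω' → ℝ),
      IsProbabilityMeasure Q ∧
      (∀ i, Measurable (Y i)) ∧
      (∀ i, ∀ᵐ ω ∂Q, 0 ≤ Y i ω) ∧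
      iIndepFun Y Q ∧
      (∀ i j, IdentDistrib (Y i) (Y j) Q Q) ∧
      IdentDistrib W (fun ω => ∑ i, Y i ω) P Q

/-- The function `L_m (s) = L (m s) ^ (1 / m)`, for a Laplace transform `L`. -/
def rescaledRoot (L : ℝ → ℝ) (m : ℕ) (s : ℝ) : ℝ :=
  L ((m : ℝ) * s) ^ (1 / (m : ℝ))

end

/-! The exponent `σ` is the essential infimum of `W`. For `x > σ`, `P(W < x) e^{-sx} ≤ L(s) ≤
e^{-sσ}`; replacing `s` by `ms` and taking `m`-th roots sends the positive factor `P(W < x)` to 1,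
so letting `x` decrease to `σ` gives `D(s) = e^{-σs}`. Hence `D = 1` exactly when `σ = 0`. Infinite
divisibility serves to make each `L_m` a Laplace transform. -/

lemma integrable_exp_neg_mul {Ω : Type*} [MeasurableSpace Ω] {P : Measure Ω} [IsFiniteMeasure P]
    {W : Ω → ℝ} (hWm : AEMeasurable W P) (hW0 : ∀ᵐ ω ∂P, 0 ≤ W ω) {s : ℝ} (hs : 0 ≤ s) :
    Integrable (fun ω => Real.exp (-s * W ω)) P := by
  refine Integrable.of_bound (C := 1) ?_ ?_
  · exact (Real.measurable_exp.comp_aemeasurable (hWm.const_mul (-s))).aestronglyMeasurable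
  · filter_upwards [hW0] with ω hω
    rw [Real.norm_eq_abs, Real.abs_exp, Real.exp_le_one_iff]
    nlinarith [mul_nonneg hs hω]

lemma laplaceTransform_nonneg {Ω : Type*} [MeasurableSpace Ω] (W : Ω → ℝ) (P : Measure Ω) (s : ℝ) :
    0 ≤ laplaceTransform W P s :=
  integral_nonneg fun _ => (Real.exp_pos _).le

lemma laplaceTransform_congr_identDistrib {Ω Ω' : Type*} [MeasurableSpace Ω] [MeasurableSpace Ω']
    {P : Measure Ω} {Q : Measure Ω'} {X : Ω → ℝ} {Y : Ω' → ℝ} (h : IdentDistrib X Y P Q) (s : ℝ) :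
    laplaceTransform X P s = laplaceTransform Y Q s :=
  (h.comp (u := fun x => Real.exp (-s * x)) (by fun_prop)).integral_eq

lemma laplaceTransform_sum_iid {Ω : Type*} [MeasurableSpace Ω] {Q : Measure Ω}
    {n : ℕ} {Y : Fin n → Ω → ℝ} (hm : ∀ i, Measurable (Y i)) (hind : iIndepFun Y Q)
    (hid : ∀ i j, IdentDistrib (Y i) (Y j) Q Q) (i₀ : Fin n) (s : ℝ) :
    laplaceTransform (fun ω => ∑ i, Y i ω) Q s = laplaceTransform (Y i₀) Q s ^ n := by
  have h1 : iIndepFun (fun i ω => Real.exp (-s * Y i ω)) Q :=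
    hind.comp (fun _ x => Real.exp (-s * x)) fun _ => by fun_prop
  have h2 := h1.integral_fun_prod_eq_prod_integral fun i =>
    (Real.measurable_exp.comp ((hm i).const_mul (-s))).aestronglyMeasurable
  have h3 : ∀ i, ∫ ω, Real.exp (-s * Y i ω) ∂Q = laplaceTransform (Y i₀) Q s := fun i =>
    laplaceTransform_congr_identDistrib (hid i i₀) s
  simp only [laplaceTransform, Finset.mul_sum, Real.exp_sum]
  rw [h2, Finset.prod_congr rfl fun i _ => h3 i]
  simp [laplaceTransform]

/-- If `W` is a sum of `m` iid copies of `Y`, then `L` is the `m`-th power of the transform of `Y`,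
so `L_m` is the transform of `mY`. -/
lemma isLaplaceTransform_rescaledRoot {Ω : Type*} [MeasurableSpace Ω] {P : Measure Ω}
    {W : Ω → ℝ} (hWdiv : IsNonnegInfinitelyDivisible W P) {m : ℕ} (hm : 0 < m) :
    IsLaplaceTransform (rescaledRoot (laplaceTransform W P) m) := by
  obtain ⟨Ω', _, Q, Y, _, hY, hY0, hind, hid, hW⟩ := hWdiv m hm
  let i₀ : Fin m := ⟨0, hm⟩
  have hmY : Measurable fun ω => (m : ℝ) * Y i₀ ω := (hY i₀).const_mul _
  refine ⟨Q.map fun ω => (m : ℝ) * Y i₀ ω, Measure.isProbabilityMeasure_map hmY.aemeasurable,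
    ?_, fun s _ => ?_⟩
  · rw [ae_map_iff hmY.aemeasurable measurableSet_Ici]
    filter_upwards [hY0 i₀] with ω hω
    positivity
  · rw [rescaledRoot, laplaceTransform_congr_identDistrib hW,
      laplaceTransform_sum_iid hY hind hid i₀, one_div,
      Real.pow_rpow_inv_natCast (laplaceTransform_nonneg _ _ _) hm.ne']
    simp only [laplaceTransform, id]
    rw [integral_map hmY.aemeasurable (by fun_prop)]
    congr 1 with ω
    ring_nf

lemma exists_essential_infimum {Ω : Type*} [MeasurableSpace Ω] {P : Measure Ω}
    [IsProbabilityMeasure P] {W : Ω → ℝ} (hW0 : ∀ᵐ ω ∂P, 0 ≤ W ω) :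
    ∃ σ : ℝ, 0 ≤ σ ∧ (∀ᵐ ω ∂P, σ ≤ W ω) ∧ ∀ x, σ < x → 0 < P {ω | W ω < x} := by
  have hb : IsBoundedUnder (· ≥ ·) (ae P) W := ⟨0, hW0⟩
  -- The real-valued `essInf` is meaningful only if `W` does not exceed every natural number almost
  -- surely.
  have hc : IsCoboundedUnder (· ≥ ·) (ae P) W := by
    have h : ∃ n : ℕ, ∃ᵐ ω ∂P, W ω ≤ n := by
      by_contra! h
      have h' : ∀ᵐ ω ∂P, ∀ n : ℕ, (n : ℝ) < W ω := by
        refine ae_all_iff.2 fun n => ?_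
        simpa [Filter.Frequently] using h n
      obtain ⟨ω, hω⟩ := h'.exists
      obtain ⟨n, hn⟩ := exists_nat_gt (W ω)
      exact (hω n).not_gt hn
    obtain ⟨n, hn⟩ := h
    exact IsCoboundedUnder.of_frequently_le hn
  have hle : ∀ x, (∀ᵐ ω ∂P, x ≤ W ω) → x ≤ essInf W P := fun x hx => le_liminf_of_le hc hx
  refine ⟨essInf W P, hle 0 hW0, ae_essInf_le hb, fun x hx => ?_⟩
  by_contra h
  refine hx.not_ge (hle x ?_)
  rw [ae_iff]
  simpa using h

lemma laplaceTransform_le_exp {Ω : Type*} [MeasurableSpace Ω] {P : Measure Ω}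
    [IsProbabilityMeasure P] {W : Ω → ℝ} (hWm : AEMeasurable W P) (hW0 : ∀ᵐ ω ∂P, 0 ≤ W ω)
    {σ : ℝ} (hσ : ∀ᵐ ω ∂P, σ ≤ W ω) {s : ℝ} (hs : 0 ≤ s) :
    laplaceTransform W P s ≤ Real.exp (-s * σ) := by
  have h : laplaceTransform W P s ≤ ∫ _, Real.exp (-s * σ) ∂P := by
    refine integral_mono_ae (integrable_exp_neg_mul hWm hW0 hs) (integrable_const _) ?_
    filter_upwards [hσ] with ω hω
    exact Real.exp_le_exp.2 (by nlinarith [mul_le_mul_of_nonneg_left hω hs])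
  simpa using h

/-- Markov's inequality for `e^{-sW}` at level `e^{-sx}`. -/
lemma measureReal_mul_exp_le_laplaceTransform {Ω : Type*} [MeasurableSpace Ω] {P : Measure Ω}
    [IsProbabilityMeasure P] {W : Ω → ℝ} (hWm : AEMeasurable W P) (hW0 : ∀ᵐ ω ∂P, 0 ≤ W ω)
    (x : ℝ) {s : ℝ} (hs : 0 ≤ s) :
    P.real {ω | W ω < x} * Real.exp (-s * x) ≤ laplaceTransform W P s := by
  have hi := integrable_exp_neg_mul hWm hW0 hs
  have h := mul_meas_ge_le_integral_of_nonneg (.of_forall fun ω => (Real.exp_pos (-s * W ω)).le)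
    hi (Real.exp (-s * x))
  refine le_trans ?_ h
  rw [mul_comm]
  refine mul_le_mul_of_nonneg_left (measureReal_mono fun ω hω => ?_) (Real.exp_pos _).le
  have hω' : W ω < x := hω
  exact Real.exp_le_exp.2 (by nlinarith [mul_le_mul_of_nonneg_left hω'.le hs])

lemma exp_natCast_mul_rpow_inv {m : ℕ} (hm : 0 < m) (a : ℝ) :
    Real.exp (m * a) ^ (1 / (m : ℝ)) = Real.exp a := by
  rw [← Real.exp_mul]
  congr 1
  field_simp

lemma tendsto_rescaledRoot_laplaceTransform {Ω : Type*} [MeasurableSpace Ω] {P : Measure Ω}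
    [IsProbabilityMeasure P] {W : Ω → ℝ} (hWm : AEMeasurable W P) (hW0 : ∀ᵐ ω ∂P, 0 ≤ W ω)
    {σ : ℝ} (hσ : ∀ᵐ ω ∂P, σ ≤ W ω) (hpos : ∀ x, σ < x → 0 < P {ω | W ω < x})
    {s : ℝ} (hs : 0 < s) :
    Tendsto (fun m : ℕ => rescaledRoot (laplaceTransform W P) m s) atTop
      (𝓝 (Real.exp (-σ * s))) := by
  refine tendsto_order.2 ⟨fun c hc => ?_, fun c hc => ?_⟩
  -- Pick `x > σ` so close to `σ` that `c < e^{-xs}` still holds.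
  · have hcont : Tendsto (fun x : ℝ => Real.exp (-x * s)) (𝓝[>] σ) (𝓝 (Real.exp (-σ * s))) :=
      (Continuous.tendsto (by fun_prop) σ).mono_left nhdsWithin_le_nhds
    obtain ⟨x, hcx, hσx⟩ := ((hcont.eventually_const_lt hc).and self_mem_nhdsWithin).exists
    have hp : 0 < P.real {ω | W ω < x} :=
      ENNReal.toReal_pos (hpos x hσx).ne' (measure_ne_top _ _)
    have hroot : Tendsto (fun m : ℕ => P.real {ω | W ω < x} ^ (1 / (m : ℝ)) * Real.exp (-x * s))
        atTop (𝓝 (Real.exp (-x * s))) := by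
      have h := (Real.continuousAt_const_rpow (b := 0) hp.ne').tendsto.comp
        (tendsto_one_div_atTop_nhds_zero_nat (𝕜 := ℝ))
      simpa [Function.comp_def] using h.mul_const (Real.exp (-x * s))
    filter_upwards [hroot.eventually_const_lt hcx, eventually_gt_atTop 0] with m hm hm0
    refine hm.trans_le ?_
    rw [← exp_natCast_mul_rpow_inv hm0, ← Real.mul_rpow hp.le (Real.exp_pos _).le, rescaledRoot]
    refine Real.rpow_le_rpow (by positivity) ?_ (by positivity)
    convert measureReal_mul_exp_le_laplaceTransform hWm hW0 x (s := m * s) (by positivity) using 3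
    ring
  · filter_upwards [eventually_gt_atTop 0] with m hm0
    refine lt_of_le_of_lt ?_ hc
    rw [← exp_natCast_mul_rpow_inv hm0, rescaledRoot]
    refine Real.rpow_le_rpow (laplaceTransform_nonneg _ _ _) ?_ (by positivity)
    convert laplaceTransform_le_exp hWm hW0 hσ (s := m * s) (by positivity) using 2
    ring

theorem theorem2 {Ω : Type*} [MeasurableSpace Ω] (P : Measure Ω) [IsProbabilityMeasure P]
    (W : Ω → ℝ) (hWm : AEMeasurable W P) (hW0 : ∀ᵐ ω ∂P, 0 ≤ W ω)
    (hWdiv : IsNonnegInfinitelyDivisible W P) :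
    (∀ m : ℕ, 0 < m → IsLaplaceTransform (rescaledRoot (laplaceTransform W P) m)) ∧
    ∃ D : ℝ → ℝ,
      (∀ s : ℝ, 0 < s →
        Tendsto (fun m : ℕ => rescaledRoot (laplaceTransform W P) m s) atTop (𝓝 (D s))) ∧
      (∃ σ : ℝ, 0 ≤ σ ∧ ∀ s : ℝ, 0 < s →
        D s = laplaceTransform id (Measure.dirac σ) s ∧ D s = Real.exp (-σ * s)) ∧
      ((∀ x : ℝ, 0 < x → 0 < P {ω | W ω < x}) ↔ ∀ s : ℝ, 0 < s → D s = 1) := by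
  refine ⟨fun m hm => isLaplaceTransform_rescaledRoot hWdiv hm, ?_⟩
  obtain ⟨σ, hσ0, hσ, hpos⟩ := exists_essential_infimum hW0
  refine ⟨fun s => Real.exp (-σ * s),
    fun s hs => tendsto_rescaledRoot_laplaceTransform hWm hW0 hσ hpos hs,
    ⟨σ, hσ0, fun s _ => ⟨?_, rfl⟩⟩, fun h s _ => ?_, fun h x hx => ?_⟩
  · simp only [laplaceTransform, integral_dirac, id]
    ring_nf
  · have hσ' : σ = 0 := by
      by_contra hne
      -- Positivity at `x = σ` fails, since `W < σ` is a null event.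
      refine (h σ (lt_of_le_of_ne hσ0 (Ne.symm hne))).ne' ?_
      simpa [ae_iff] using hσ
    simp [hσ']
  · have hσ' : σ = 0 := by simpa using h 1 one_pos
    exact hpos x (hσ' ▸ hx)
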